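/- **Setting.** A simplicial complex is a finite family $\Delta$ of finite sets of integers (its faces) that contains $\emptyset$ and is closed under passing to subsets; $\Delta_i$ is the set of faces of dimension $i$ (that is, with $i+1$ elements), and $d=\dim\Delta\ge -1$ is the largest dimension of a face. For finite sets of integers $A=\{a_1<\dots<a_m\}$ and $B=\{b_1<\dots<b_n\}$ write $A\preceq B$ if $m=n$ and $a_j\le b_j$ for all $j$. The complex $\Delta$ is shifted if there are integers $p,q$ such that every face is contained in $[p,q]=\{p,\dots,q\}$ and, whenever $B\in\Delta$, $A\subseteq[p,q]$ and $A\preceq B$, also $A\in\Delta$. Let $\Bbbk$ be the field of rational functions in indeterminates $x_{i,j}$ ($i,j\in\mathbb Z$) over a field of characteristic zero, and let $\uparrow$ be the field endomorphism of $\Bbbk$ that fixes the coefficients and sends $x_{i,j}$ to $x_{i+1,j}$. For a multiset of integers $S=\{s_1\le\dots\le s_m\}$ put $x_S=x_{1,s_1}x_{2,s_2}\cdots x_{m,s_m}$ and $X_S=x_S^2$. Put $\varepsilon(j,F)=(-1)^{t+1}$ if $j$ is the $t$-th smallest element of $F$. Let $C_i(\Delta)$ be the $\Bbbk$-vector space with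 basis $\{[F]:F\in\Delta_i\}$. The algebraic finely weighted boundary map $\partial_i:C_i(\Delta)\to C_{i-1}(\Delta)$ and coboundary map $\partial_i^*:C_{i-1}(\Delta)\to C_i(\Delta)$ are $$\partial_i[F]=\sum_{j\in F}\varepsilon(j,F)\,\frac{\uparrow^{d-i}(x_F)}{\uparrow^{d-i+1}(x_{F\setminus j})}\,[F\setminus j],\qquad \partial_i^*[F]=\sum_{j\notin F,\ F\cup j\in\Delta}\varepsilon(j,F\cup j)\,\frac{\uparrow^{d-i}(x_{F\cup j})}{\uparrow^{d-i+1}(x_F)}\,[F\cup j].$$ Let $\mathrm{Spec}^{ud}_{i-1}(\Delta)$ be the multiset of eigenvalues (in an algebraic closure of $\Bbbk$, with multiplicity) of $\partial_i\partial_i^*$ acting on $C_{i-1}(\Delta)$. For a finite family $\mathcal F$ of finite sets of integers, a critical pair is a pair $(A,B)$ with $A\in\mathcal F$, $B\notin\mathcal F$ and $B=(A\setminus\{a\})\cup\{a+1\}$ for some $a\in A$ with $a+1\notin A$. Its long signature is $(S,T)$ with $S=\{v\in A: v<a\}$ and $T=[p,a]$, where $p$ is the smallest integer occurring in a member of $\mathcal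 F$. For multisets of integers $S,T$, the $z$-polynomial is $$z(S,T)=\frac{1}{\uparrow X_S}\sum_{j\in T}X_{S\cup j},$$ with $\cup$ denoting multiset union. **Corollary.** 1. A shifted complex is completely determined by its spectra: if $\Delta$ and $\Gamma$ are shifted complexes and the families $\{\mathrm{Spec}^{ud}_{i-1}(\Delta)\}_{i=0}^{\dim\Delta}$ and $\{\mathrm{Spec}^{ud}_{i-1}(\Gamma)\}_{i=0}^{\dim\Gamma}$ are equal (as finite sequences, so in particular of the same length), then $\Delta=\Gamma$. 2. A long signature can be read off from its $z$-polynomial: if $(S,T)$ and $(S',T')$ are long signatures of critical pairs of finite families $\mathcal F$ and $\mathcal G$ of finite sets of integers, and $z(S,T)=z(S',T')$, then $S=S'$ and $T=T'$. 3. The long signatures recover all $\preceq$-maximal faces: if $F$ is a nonempty $\preceq$-maximal face of a shifted complex $\Delta$ and $i=\dim F$, then $F=S\cup\{\max T\}$ for the long signature $(S,T)$ of some critical pair of $\Delta_i$. 4. Hence they recover all nonempty faces: a nonempty finite set $G$ of integers is a face of a shifted complex $\Delta$ if and only if, for some $i$, some long signature $(S,T)$ of a critical pair of $\Delta_i$ satisfies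 $G\subseteq T$ and $G\preceq S\cup\{\max T\}$. -/

import Mathlib

namespace FineShifted

noncomputable section

/-- A finite simplicial complex whose vertices are integers: a finite family of finite sets of
integers that contains the empty set and is closed under passing to subsets. -/
@[ext]
structure SimpComplex where
  faces : Finset (Finset ℤ)
  empty_mem : ∅ ∈ faces
  down_closed : ∀ F ∈ faces, ∀ G ⊆ F, G ∈ faces

/-- The componentwise partial order on finite sets of integers:
`{a₁ < ⋯ < aₘ} ⪯ {b₁ < ⋯ < bₙ}` iff `m = n` and `aⱼ ≤ bⱼ` for all `j`. -/
def CompLE (A B : Finset ℤ) : Prop :=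
  List.Forall₂ (fun a b : ℤ => a ≤ b) (A.sort (· ≤ ·)) (B.sort (· ≤ ·))

/-- `Δ.level k` is the set of faces with exactly `k` elements, that is, of dimension `k - 1`. -/
def SimpComplex.level (Δ : SimpComplex) (k : ℕ) : Finset (Finset ℤ) :=
  Δ.faces.filter fun F => F.card = k

/-- `Δ.size = d + 1`, where `d = dim Δ` (so `d = -1` if the empty set is the only face). -/
def SimpComplex.size (Δ : SimpComplex) : ℕ := Δ.faces.sup Finset.card

/-- `Δ` is shifted: for some integer interval `[p, q]` it is a complex on the vertex set `[p, q]`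
whose faces form an order ideal for the componentwise order on subsets of `[p, q]`. -/
def SimpComplex.IsShifted (Δ : SimpComplex) : Prop :=
  ∃ p q : ℤ, (∀ F ∈ Δ.faces, F ⊆ Finset.Icc p q) ∧
    ∀ A B : Finset ℤ, B ∈ Δ.faces → A ⊆ Finset.Icc p q → CompLE A B → A ∈ Δ.faces

section Weights

/-- The field of rational functions over `𝕜` in indeterminates `x_{i,j}`, with `i`, `j` integers. -/
abbrev RatField (𝕜 : Type*) [Field 𝕜] : Type _ := FractionRing (MvPolynomial (ℤ × ℤ) 𝕜)

variable (𝕜 : Type*) [Field 𝕜]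

/-- The indeterminate `x_{i,j}`. -/
def indet (i j : ℤ) : RatField 𝕜 :=
  algebraMap (MvPolynomial (ℤ × ℤ) 𝕜) (RatField 𝕜) (MvPolynomial.X (i, j))

theorem succ_fst_injective :
    Function.Injective (fun ij : ℤ × ℤ => ((ij.1 + 1, ij.2) : ℤ × ℤ)) := by
  rintro ⟨a, b⟩ ⟨c, d⟩ h
  simpa using h

theorem rename_succ_injective :
    Function.Injective ((MvPolynomial.rename (R := 𝕜)
      (fun ij : ℤ × ℤ => ((ij.1 + 1, ij.2) : ℤ × ℤ))).toRingHom :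
        MvPolynomial (ℤ × ℤ) 𝕜 →+* MvPolynomial (ℤ × ℤ) 𝕜) :=
  MvPolynomial.rename_injective _ succ_fst_injective

/-- The raising operator: the field endomorphism over `𝕜` with `x_{i,j} ↦ x_{i+1,j}`. -/
def raise : RatField 𝕜 →+* RatField 𝕜 :=
  IsFractionRing.map (rename_succ_injective 𝕜)

theorem raise_indet (i j : ℤ) : raise 𝕜 (indet 𝕜 i j) = indet 𝕜 (i + 1) j := by
  unfold raise indet IsFractionRing.map
  rw [IsLocalization.map_eq]
  simp

/-- `x_S = x_{1,i₁} x_{2,i₂} ⋯ x_{m,iₘ}` for a multiset `S = {i₁ ≤ i₂ ≤ ⋯ ≤ iₘ}`. -/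
def monomialx (S : Multiset ℤ) : RatField 𝕜 :=
  ((S.sort (· ≤ ·)).mapIdx fun k v => indet 𝕜 ((k : ℤ) + 1) v).prod

/-- `X_S = x_S²`. -/
def monomialX (S : Multiset ℤ) : RatField 𝕜 := monomialx 𝕜 S ^ 2

/-- `ε(v, F) = (-1)^(j+1)` if `v` is the `j`-th smallest element of `F`, and `0` if `v ∉ F`. -/
def sgn (v : ℤ) (F : Finset ℤ) : RatField 𝕜 :=
  if v ∈ F then (-1) ^ (F.filter fun u => u < v).card else 0

/-- The algebraic finely weighted boundary map from chains on faces of dimension `k` (`k + 1`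
elements) to chains on faces of dimension `k - 1` (`k` elements), as a matrix; column `F` holds
`∑_{j ∈ F} ε(j, F) ↑^(d-k)(x_F) / ↑^(d-k+1)(x_{F ∖ j}) [F ∖ j]`, where `d - k = size - (k + 1)`. -/
def boundary (Δ : SimpComplex) (k : ℕ) : Matrix (Δ.level k) (Δ.level (k + 1)) (RatField 𝕜) :=
  fun G F => ∑ j ∈ F.1, if F.1.erase j = G.1 then
    sgn 𝕜 j F.1 * ((raise 𝕜)^[Δ.size - (k + 1)] (monomialx 𝕜 F.1.val) /
      (raise 𝕜)^[Δ.size - (k + 1) + 1] (monomialx 𝕜 (F.1.erase j).val)) else 0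

/-- The algebraic finely weighted coboundary map from chains on faces of dimension `k - 1`
to chains on faces of dimension `k`, as a matrix; column `F` holds
`∑_{j ∉ F, F ∪ j ∈ Δ} ε(j, F ∪ j) ↑^(d-k)(x_{F ∪ j}) / ↑^(d-k+1)(x_F) [F ∪ j]`. -/
def coboundary (Δ : SimpComplex) (k : ℕ) : Matrix (Δ.level (k + 1)) (Δ.level k) (RatField 𝕜) :=
  fun H F => ∑ j ∈ H.1 \ F.1, if insert j F.1 = H.1 then
    sgn 𝕜 j (insert j F.1) *
      ((raise 𝕜)^[Δ.size - (k + 1)] (monomialx 𝕜 (insert j F.1).val) /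
        (raise 𝕜)^[Δ.size - (k + 1) + 1] (monomialx 𝕜 F.1.val)) else 0

/-- The algebraic finely weighted up-down Laplacian on chains on faces of dimension `k - 1`:
first the coboundary, then the boundary. -/
def upDownLaplacian (Δ : SimpComplex) (k : ℕ) : Matrix (Δ.level k) (Δ.level k) (RatField 𝕜) :=
  boundary 𝕜 Δ k * coboundary 𝕜 Δ k

/-- The spectrum of the up-down Laplacian on chains on faces of dimension `i - 1`: the multiset of
its eigenvalues (roots of the characteristic polynomial in an algebraic closure, with
multiplicity). -/
def spec (Δ : SimpComplex) (i : ℕ) : Multiset (AlgebraicClosure (RatField 𝕜)) :=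
  (upDownLaplacian 𝕜 Δ i).charpoly.aroots (AlgebraicClosure (RatField 𝕜))

/-- The family of spectra in dimensions `i - 1`, for `i = 0, …, d`, as a list of length `d + 1`. -/
def spectra (Δ : SimpComplex) : List (Multiset (AlgebraicClosure (RatField 𝕜))) :=
  (List.range Δ.size).map fun i => spec 𝕜 Δ i

/-- The `z`-polynomial `z(S, T) = (1 / ↑X_S) ∑_{j ∈ T} X_{S ∪ j}`, with multiset union. -/
def zPoly (S T : Multiset ℤ) : RatField 𝕜 :=
  1 / raise 𝕜 (monomialX 𝕜 S) * (T.map fun j => monomialX 𝕜 (j ::ₘ S)).sum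

end Weights

/-- `B` covers `A` in the componentwise order: one element `a` of `A` is replaced by `a + 1`,
which was not in `A`. -/
def Covers (A B : Finset ℤ) : Prop :=
  ∃ a ∈ A, a + 1 ∉ A ∧ B = insert (a + 1) (A.erase a)

/-- `(A, B)` is a critical pair for the family `𝓕`. -/
def IsCriticalPair (𝓕 : Finset (Finset ℤ)) (A B : Finset ℤ) : Prop :=
  A ∈ 𝓕 ∧ B ∉ 𝓕 ∧ Covers A B

/-- The smallest integer occurring in a member of `𝓕` (with value `0` if there is none). -/
def initialVertex (𝓕 : Finset (Finset ℤ)) : ℤ := (𝓕.biUnion id).min.untopD 0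

/-- `(S, T)` is the long signature of a critical pair `(A, B)` for `𝓕`: if `B` arises from `A` by
replacing `a` by `a + 1`, then `S = {v ∈ A : v < a}` and `T = [p, a]`, where `p` is the smallest
integer occurring in a member of `𝓕`. -/
def IsLongSignature (𝓕 : Finset (Finset ℤ)) (S T : Finset ℤ) : Prop :=
  ∃ A B : Finset ℤ, IsCriticalPair 𝓕 A B ∧ ∃ a ∈ A \ B,
    S = A.filter (fun v => v < a) ∧ T = Finset.Icc (initialVertex 𝓕) a

end

end FineShifted

/-! Everything rests on one cancellation. In `x_F / ↑x_{F ∖ j}` the vertices above `j` occupy the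
same positions in numerator and denominator, so only the initial segment `G = {v ∈ F : v ≤ j}`
survives and the square is `X_G / ↑X_{G ∖ max G}` (`monomialx_cons_div`). These Laurent monomials
are distinct for distinct `G`, hence linearly independent, so in characteristic zero a sum of them
determines the multiset of sets `G`.

The sum of the eigenvalues is the trace, which is a power of `↑` applied to the sum of these
monomials over all pairs `j ∈ F`. It determines the multiset of initial segments of the faces of one
dimension, and those of full size are the faces themselves. Likewise `z(S, T)` determines the sets
`{v ∈ S : v < j} ∪ {j}` for `j ∈ T`: their maxima give `T`, and the one with `j = max T` gives `S`.

For maximal faces, raising the largest vertex by one leaves the complex and so gives a critical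
pair. Every face lies below a maximal one, and shiftedness gives the converse. -/

/-! ### Linear independence of Laurent monomials -/

open MvPolynomial in
/-- Quotients of monomials with pairwise distinct exponents `a i - b i` are linearly independent. -/
theorem FineShifted.linearIndependent_monomial_div {σ ι : Type*} (𝕜 : Type*) [Field 𝕜]
    (a b : ι → σ →₀ ℕ) (h : ∀ i j, a i + b j = a j + b i → i = j) :
    LinearIndependent 𝕜 fun i =>
      algebraMap (MvPolynomial σ 𝕜) (FractionRing (MvPolynomial σ 𝕜)) (monomial (a i) 1) /
        algebraMap (MvPolynomial σ 𝕜) (FractionRing (MvPolynomial σ 𝕜)) (monomial (b i) 1) := by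
  classical
  rw [linearIndependent_iff']
  intro s g hg i hi
  set φ := algebraMap (MvPolynomial σ 𝕜) (FractionRing (MvPolynomial σ 𝕜)) with hφ
  have hinj : Function.Injective φ := IsFractionRing.injective _ _
  -- `D` is a common denominator: multiplying by its monomial turns the relation into one between
  -- polynomials.
  set D := ∑ i ∈ s, b i
  have hbD : ∀ i ∈ s, b i ≤ D := fun i hi =>
    Finset.single_le_sum (f := b) (fun _ _ => zero_le) hi
  have hterm : ∀ i ∈ s, (g i • (φ (monomial (a i) 1) / φ (monomial (b i) 1))) *
      φ (monomial D 1) = φ (monomial (a i + (D - b i)) (g i)) := by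
    intro i hi
    have h0 : φ (monomial (b i) 1) ≠ 0 := by
      rw [Ne, map_eq_zero_iff φ hinj]
      simp
    have h1 : (monomial D 1 : MvPolynomial σ 𝕜) = monomial (b i) 1 * monomial (D - b i) 1 := by
      rw [monomial_mul, add_tsub_cancel_of_le (hbD i hi), one_mul]
    have h2 : (monomial (a i + (D - b i)) (g i) : MvPolynomial σ 𝕜) =
        C (g i) * (monomial (a i) 1 * monomial (D - b i) 1) := by
      rw [monomial_mul, C_mul_monomial]; simp
    rw [h1, h2, map_mul, map_mul, map_mul, Algebra.smul_def,
      IsScalarTower.algebraMap_apply 𝕜 (MvPolynomial σ 𝕜) (FractionRing (MvPolynomial σ 𝕜)),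
      MvPolynomial.algebraMap_eq, ← hφ]
    field_simp
  have hsum : ∑ i ∈ s, (monomial (a i + (D - b i)) (g i) : MvPolynomial σ 𝕜) = 0 := by
    apply hinj
    rw [map_sum, ← Finset.sum_congr rfl hterm, ← Finset.sum_mul, hg, zero_mul, map_zero]
  have hc := congrArg (coeff (a i + (D - b i))) hsum
  rw [coeff_sum, Finset.sum_eq_single i, coeff_monomial, if_pos rfl, coeff_zero] at hc
  · exact hc
  · intro j hj hji
    rw [coeff_monomial, if_neg]
    intro he
    apply hji
    apply h
    ext x
    have h1 := DFunLike.congr_fun he x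
    have h2 := hbD i hi x
    have h3 := hbD j hj x
    simp only [Finsupp.add_apply, Finsupp.tsub_apply] at h1 ⊢
    omega
  · exact fun h => absurd hi h

/-- In characteristic zero a multiset is determined by the sum of a linearly independent family
over it. -/
theorem FineShifted.multiset_eq_of_sum_eq {ι : Type*} {𝕜 V : Type*} [Field 𝕜] [CharZero 𝕜]
    [AddCommGroup V] [Module 𝕜 V] {v : ι → V} (hv : LinearIndependent 𝕜 v) {M N : Multiset ι}
    (h : (M.map v).sum = (N.map v).sum) : M = N := by
  classical
  -- Multiplicities are natural numbers; characteristic zero embeds them in the field.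
  have hv' : LinearIndependent ℕ v :=
    hv.restrict_scalars (by
      simpa [nsmul_eq_mul] using (Nat.cast_injective : Function.Injective ((↑) : ℕ → 𝕜)))
  have key : ∀ M : Multiset ι, Finsupp.linearCombination ℕ v (Multiset.toFinsupp M) =
      (M.map v).sum := by
    intro M
    induction M using Multiset.induction_on with
    | empty => simp
    | cons i M ih =>
      rw [← Multiset.singleton_add, Multiset.toFinsupp_add, map_add, ih]
      simp
  apply Multiset.toFinsupp.injective
  apply hv'
  rw [key, key, h]

namespace FineShifted
noncomputable section

/-! ### Exponents and monomials of lists -/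

/-- The exponent of `x_{n+1,v₁} x_{n+2,v₂} ⋯` for a list `v₁, v₂, …`. -/
def listExponent : ℕ → List ℤ → (ℤ × ℤ →₀ ℕ)
  | _, [] => 0
  | n, v :: l => Finsupp.single ((n : ℤ) + 1, v) 1 + listExponent (n + 1) l

theorem listExponent_append (n : ℕ) (l l' : List ℤ) :
    listExponent n (l ++ l') = listExponent n l + listExponent (n + l.length) l' := by
  induction l generalizing n with
  | nil => simp [listExponent]
  | cons v l ih =>
    simp only [List.cons_append, listExponent, ih, List.length_cons, add_assoc]
    rw [show n + (1 + l.length) = n + (l.length + 1) by omega]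

theorem listExponent_ne_zero_iff (n : ℕ) (l : List ℤ) (k v : ℤ) :
    listExponent n l (k, v) ≠ 0 ↔ ∃ i : ℕ, l[i]? = some v ∧ k = n + 1 + i := by
  induction l generalizing n with
  | nil => simp [listExponent]
  | cons u l ih =>
    rw [listExponent, Finsupp.add_apply, Ne, add_eq_zero, not_and_or, ← Ne, ← Ne, ih,
      Finsupp.single_apply]
    constructor
    · rintro (h | ⟨i, hi, hk⟩)
      · rw [ne_eq, ite_eq_right_iff, Prod.mk.injEq] at h
        have h' : (n : ℤ) + 1 = k ∧ u = v := by tauto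
        exact ⟨0, by simp [h'.2], by simp [h'.1]⟩
      · exact ⟨i + 1, by simpa using hi, by push_cast at hk ⊢; linarith⟩
    · rintro ⟨i, hi, hk⟩
      cases i with
      | zero =>
        left
        have : u = v := by simpa using hi
        simp [this, hk]
      | succ i => exact Or.inr ⟨i, by simpa using hi, by push_cast at hk ⊢; linarith⟩

/-- The exponents of `x_G / ↑x_{G ∖ max G}` are pairwise distinct. -/
theorem eq_of_listExponent_eq {l l' : List ℤ} (hl : l.Nodup) (hl' : l'.Nodup)
    (h : listExponent 0 l + listExponent 1 l'.dropLast =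
      listExponent 0 l' + listExponent 1 l.dropLast) : l = l' := by
  have key : ∀ {l l' : List ℤ}, l.Nodup → listExponent 0 l + listExponent 1 l'.dropLast =
      listExponent 0 l' + listExponent 1 l.dropLast →
      ∀ (i : ℕ) (v : ℤ), l[i]? = some v → l'[i]? = some v := by
    intro l l' hl h i v hi
    have h1 : listExponent 0 l ((i : ℤ) + 1, v) ≠ 0 :=
      (listExponent_ne_zero_iff ..).2 ⟨i, hi, by push_cast; ring⟩
    -- In the raised monomial this variable would put `v` at position `i - 1` of `l` as well,
    -- against distinctness. So it cannot be absorbed on the right and must come from `l'`.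
    have h2 : listExponent 1 l.dropLast ((i : ℤ) + 1, v) = 0 := by
      by_contra hne
      obtain ⟨j, hj, hk⟩ := (listExponent_ne_zero_iff ..).1 hne
      have hij : i = j + 1 := by push_cast at hk; omega
      have hj' : l[j]? = some v := by
        rw [List.getElem?_dropLast] at hj
        split_ifs at hj with hlt
        exact hj
      have hlen : j < l.length := (List.getElem?_eq_some_iff.1 hj').1
      have := (List.getElem?_inj hlen hl).1 (hj'.trans hi.symm)
      omega
    have h3 := DFunLike.congr_fun h ((i : ℤ) + 1, v)
    rw [Finsupp.add_apply, Finsupp.add_apply, h2] at h3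
    obtain ⟨j, hj, hk⟩ := (listExponent_ne_zero_iff 0 l' ((i : ℤ) + 1) v).1 (by omega)
    have : i = j := by push_cast at hk; omega
    rwa [this]
  apply List.ext_getElem?
  intro i
  apply Option.ext
  intro v
  exact ⟨key hl h i v, key hl' h.symm i v⟩

variable (𝕜 : Type*) [Field 𝕜]

/-- The monomial `x_{n+1,v₁} x_{n+2,v₂} ⋯` for a list `v₁, v₂, …`. -/
def listMonomial (n : ℕ) (l : List ℤ) : RatField 𝕜 :=
  algebraMap (MvPolynomial (ℤ × ℤ) 𝕜) (RatField 𝕜) (MvPolynomial.monomial (listExponent n l) 1)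

theorem listMonomial_ne_zero (n : ℕ) (l : List ℤ) : listMonomial 𝕜 n l ≠ 0 := by
  intro h
  rw [listMonomial, map_eq_zero_iff _ (IsFractionRing.injective _ _)] at h
  simp at h

theorem listMonomial_nil (n : ℕ) : listMonomial 𝕜 n [] = 1 := by
  simp [listMonomial, listExponent]

theorem listMonomial_cons (n : ℕ) (v : ℤ) (l : List ℤ) :
    listMonomial 𝕜 n (v :: l) = indet 𝕜 (n + 1) v * listMonomial 𝕜 (n + 1) l := by
  rw [listMonomial, listExponent, indet, listMonomial, ← map_mul, MvPolynomial.X,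
    MvPolynomial.monomial_mul, one_mul]

theorem raise_listMonomial (n : ℕ) (l : List ℤ) :
    raise 𝕜 (listMonomial 𝕜 n l) = listMonomial 𝕜 (n + 1) l := by
  induction l generalizing n with
  | nil => simp [listMonomial_nil]
  | cons v l ih =>
    rw [listMonomial_cons, listMonomial_cons, map_mul, ih, raise_indet]
    push_cast
    rfl

theorem prod_mapIdx_indet (n : ℕ) (l : List ℤ) :
    (l.mapIdx fun k v => indet 𝕜 (((n + k : ℕ) : ℤ) + 1) v).prod = listMonomial 𝕜 n l := by
  induction l generalizing n with
  | nil => simp [listMonomial_nil]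
  | cons v l ih =>
    rw [List.mapIdx_cons, List.prod_cons, listMonomial_cons, ← ih, add_zero]
    simp only [add_assoc, add_comm 1]

theorem monomialx_eq_listMonomial (S : Multiset ℤ) :
    monomialx 𝕜 S = listMonomial 𝕜 0 (S.sort (· ≤ ·)) := by
  rw [← prod_mapIdx_indet, monomialx]
  simp

/-! ### Weights of initial segments -/

/-- The Laurent monomial `X_G / ↑X_{G ∖ max G}`. -/
def headRatio (G : Finset ℤ) : RatField 𝕜 :=
  (listMonomial 𝕜 0 (G.sort (· ≤ ·)) / listMonomial 𝕜 1 (G.sort (· ≤ ·)).dropLast) ^ 2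

theorem linearIndependent_headRatio : LinearIndependent 𝕜 (headRatio 𝕜) := by
  have := linearIndependent_monomial_div 𝕜
    (fun G : Finset ℤ => 2 • listExponent 0 (G.sort (· ≤ ·)))
    (fun G : Finset ℤ => 2 • listExponent 1 (G.sort (· ≤ ·)).dropLast) (by
      intro G H h
      simp only [← smul_add] at h
      have h' := eq_of_listExponent_eq (Finset.sort_nodup ..) (Finset.sort_nodup ..)
        (nsmul_right_injective two_ne_zero h)
      rw [← Finset.sort_toFinset (s := G) (· ≤ ·), h', Finset.sort_toFinset])
  convert this using 2 with G
  rw [headRatio, div_pow, listMonomial, listMonomial, ← map_pow (algebraMap _ _),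
    ← map_pow (algebraMap _ _), MvPolynomial.monomial_pow, MvPolynomial.monomial_pow, one_pow]

theorem sort_insert_of_forall_lt {P : Finset ℤ} {j : ℤ} (h : ∀ v ∈ P, v < j) :
    (insert j P).sort (· ≤ ·) = P.sort (· ≤ ·) ++ [j] := by
  have hj : j ∉ P := fun hj => lt_irrefl _ (h j hj)
  apply List.Perm.eq_of_pairwise' (r := (· ≤ ·)) (Finset.pairwise_sort ..)
  · rw [List.pairwise_append]
    refine ⟨Finset.pairwise_sort .., List.pairwise_singleton .., ?_⟩
    intro a ha b hb
    rw [List.mem_singleton] at hb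
    rw [Finset.mem_sort] at ha
    exact hb ▸ (h a ha).le
  · rw [← Multiset.coe_eq_coe, Finset.sort_eq, Finset.insert_val_of_notMem hj,
      ← Multiset.coe_add, Finset.sort_eq, Multiset.coe_singleton, add_comm,
      Multiset.singleton_add]

/-- Only the elements below `j` matter in `X_{S ∪ j} / ↑X_S`. -/
theorem monomialx_cons_div (S : Finset ℤ) (j : ℤ) :
    (monomialx 𝕜 (j ::ₘ S.val) / raise 𝕜 (monomialx 𝕜 S.val)) ^ 2 =
      headRatio 𝕜 (insert j (S.filter (· < j))) := by
  set P := S.filter (· < j) with hP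
  set Q := S.filter (¬ · < j) with hQ
  have hlt : ∀ v ∈ P, v < j := fun v hv => (Finset.mem_filter.1 hv).2
  have hge : ∀ v ∈ Q, j ≤ v := fun v hv => not_lt.1 (Finset.mem_filter.1 hv).2
  have hPQ : P.val + Q.val = S.val := by
    rw [hP, hQ, Finset.filter_val, Finset.filter_val, Multiset.filter_add_not]
  have hS : S.val.sort (· ≤ ·) = P.sort (· ≤ ·) ++ Q.sort (· ≤ ·) := by
    apply List.Perm.eq_of_pairwise' (r := (· ≤ ·)) (Multiset.pairwise_sort ..)
    · rw [List.pairwise_append]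
      refine ⟨Finset.pairwise_sort .., Finset.pairwise_sort .., ?_⟩
      intro a ha b hb
      rw [Finset.mem_sort] at ha hb
      exact (hlt a ha).le.trans (hge b hb)
    · rw [← Multiset.coe_eq_coe, Multiset.sort_eq, ← Multiset.coe_add, Finset.sort_eq,
        Finset.sort_eq, hPQ]
  have hjS : (j ::ₘ S.val).sort (· ≤ ·) = P.sort (· ≤ ·) ++ j :: Q.sort (· ≤ ·) := by
    apply List.Perm.eq_of_pairwise' (r := (· ≤ ·)) (Multiset.pairwise_sort ..)
    · rw [List.pairwise_append, List.pairwise_cons]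
      refine ⟨Finset.pairwise_sort .., ⟨?_, Finset.pairwise_sort ..⟩, ?_⟩
      · intro b hb
        rw [Finset.mem_sort] at hb
        exact hge b hb
      · intro a ha b hb
        rw [Finset.mem_sort] at ha
        rw [List.mem_cons, Finset.mem_sort] at hb
        rcases hb with rfl | hb
        · exact (hlt a ha).le
        · exact (hlt a ha).le.trans (hge b hb)
    · rw [← Multiset.coe_eq_coe, Multiset.sort_eq, ← Multiset.coe_add, Finset.sort_eq,
        ← Multiset.cons_coe, Finset.sort_eq, Multiset.add_cons, hPQ]
  rw [monomialx_eq_listMonomial, monomialx_eq_listMonomial, raise_listMonomial, headRatio,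
    sort_insert_of_forall_lt hlt, List.dropLast_concat, hS, hjS]
  congr 1
  rw [div_eq_div_iff (listMonomial_ne_zero 𝕜 _ _) (listMonomial_ne_zero 𝕜 _ _), listMonomial,
    listMonomial, listMonomial, listMonomial, ← map_mul, ← map_mul, MvPolynomial.monomial_mul,
    MvPolynomial.monomial_mul]
  congr 2
  -- The entries of `Q` start at first index `|P| + 2` on both sides: `j` shifts them in one
  -- monomial, the raising operator in the other.
  simp only [listExponent_append, listExponent, zero_add, add_zero]
  rw [add_comm 1 (P.sort (· ≤ ·)).length]
  congr 1
  abel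

/-! ### The componentwise order -/

theorem CompLE.trans {A B C : Finset ℤ} (h : CompLE A B) (h' : CompLE B C) : CompLE A C := by
  have key : ∀ {l m n : List ℤ}, List.Forall₂ (fun a b : ℤ => a ≤ b) l m →
      List.Forall₂ (fun a b : ℤ => a ≤ b) m n → List.Forall₂ (fun a b : ℤ => a ≤ b) l n := by
    intro l m n h
    induction h generalizing n with
    | nil => exact id
    | cons h _ ih =>
      intro h'
      cases h' with
      | cons h₁ h₂ => exact List.Forall₂.cons (h.trans h₁) (ih h₂)
  exact key h h'

theorem CompLE.refl (A : Finset ℤ) : CompLE A A :=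
  List.forall₂_same.2 fun _ _ => le_rfl

theorem CompLE.card_eq {A B : Finset ℤ} (h : CompLE A B) : A.card = B.card := by
  simpa using List.Forall₂.length_eq h

/-- The sum of the elements is strictly monotone for `⪯`, so maximizing it over finitely many faces
produces a `⪯`-maximal face. -/
theorem CompLE.eq_of_sum_le {A B : Finset ℤ} (h : CompLE A B)
    (hs : ∑ b ∈ B, b ≤ ∑ a ∈ A, a) : A = B := by
  have hsum : ∀ {l m : List ℤ}, List.Forall₂ (fun a b : ℤ => a ≤ b) l m → l.sum ≤ m.sum :=
    fun h => List.Forall₂.sum_le_sum h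
  have key : ∀ {l m : List ℤ}, List.Forall₂ (fun a b : ℤ => a ≤ b) l m → m.sum ≤ l.sum →
      l = m := by
    intro l m h
    induction h with
    | nil => simp
    | cons h₁ h₂ ih =>
      intro hs
      rw [List.sum_cons, List.sum_cons] at hs
      have := hsum h₂
      rw [ih (by linarith), le_antisymm h₁ (by linarith)]
  have hsort : ∀ A : Finset ℤ, (A.sort (· ≤ ·)).sum = ∑ a ∈ A, a := by
    intro A
    rw [← Multiset.sum_coe, Finset.sort_eq, Finset.sum, Multiset.map_id']
  have := key h (by rwa [hsort, hsort])
  rw [← Finset.sort_toFinset (s := A) (· ≤ ·), this, Finset.sort_toFinset]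

theorem CompLE.exists_le {A B : Finset ℤ} (h : CompLE A B) {a : ℤ} (ha : a ∈ A) :
    ∃ b ∈ B, a ≤ b := by
  have key : ∀ {l m : List ℤ}, List.Forall₂ (fun a b : ℤ => a ≤ b) l m →
      ∀ a ∈ l, ∃ b ∈ m, a ≤ b := by
    intro l m h
    induction h with
    | nil => simp
    | cons h₁ h₂ ih =>
      intro a ha
      rcases List.mem_cons.1 ha with rfl | ha
      · exact ⟨_, List.mem_cons_self, h₁⟩
      · obtain ⟨b, hb, hab⟩ := ih a ha
        exact ⟨b, List.mem_cons_of_mem _ hb, hab⟩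
  simpa using key h a (by simpa using ha)

/-- Every face lies below a `⪯`-maximal face. -/
theorem SimpComplex.exists_maximal (Δ : SimpComplex) {G : Finset ℤ} (hG : G ∈ Δ.faces) :
    ∃ F ∈ Δ.faces, CompLE G F ∧ ∀ H ∈ Δ.faces, CompLE F H → H = F := by
  classical
  obtain ⟨F, hF, hmax⟩ := (Δ.faces.filter (CompLE G)).exists_max_image (fun H => ∑ v ∈ H, v)
    ⟨G, Finset.mem_filter.2 ⟨hG, CompLE.refl G⟩⟩
  rw [Finset.mem_filter] at hF
  refine ⟨F, hF.1, hF.2, fun H hH hFH => ?_⟩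
  exact (hFH.eq_of_sum_le (hmax H (Finset.mem_filter.2 ⟨hH, hF.2.trans hFH⟩))).symm

/-! ### Long signatures and maximal faces -/

theorem initialVertex_le {𝓕 : Finset (Finset ℤ)} {A : Finset ℤ} (hA : A ∈ 𝓕) {v : ℤ}
    (hv : v ∈ A) : initialVertex 𝓕 ≤ v := by
  have hm : v ∈ 𝓕.biUnion id := Finset.mem_biUnion.2 ⟨A, hA, hv⟩
  obtain ⟨m, hmin⟩ := Finset.min_of_mem hm
  rw [initialVertex, hmin]
  exact Finset.min_le_of_eq hm hmin

theorem exists_initialVertex_mem {𝓕 : Finset (Finset ℤ)} {A : Finset ℤ} (hA : A ∈ 𝓕) {v : ℤ}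
    (hv : v ∈ A) : ∃ F ∈ 𝓕, initialVertex 𝓕 ∈ F := by
  have hm : v ∈ 𝓕.biUnion id := Finset.mem_biUnion.2 ⟨A, hA, hv⟩
  obtain ⟨m, hmin⟩ := Finset.min_of_mem hm
  rw [initialVertex, hmin]
  simpa using Finset.mem_of_min hmin

theorem SimpComplex.mem_level {Δ : SimpComplex} {k : ℕ} {F : Finset ℤ} :
    F ∈ Δ.level k ↔ F ∈ Δ.faces ∧ F.card = k :=
  Finset.mem_filter

/-- The long signature of the critical pair that raises the largest vertex of a maximal face. -/
theorem isLongSignature_of_maximal (Δ : SimpComplex) {F : Finset ℤ} (hF : F ∈ Δ.faces)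
    (hne : F.Nonempty) (hmax : ∀ G ∈ Δ.faces, CompLE F G → G = F) :
    IsLongSignature (Δ.level F.card) (F.filter (· < F.max' hne))
      (Finset.Icc (initialVertex (Δ.level F.card)) (F.max' hne)) := by
  set a := F.max' hne with ha
  have haF : a ∈ F := F.max'_mem hne
  have hle : ∀ v ∈ F, v ≤ a := fun v hv => F.le_max' v hv
  have ha1 : a + 1 ∉ F := fun h => by have := hle _ h; omega
  have hlt : ∀ v ∈ F.erase a, v < a := fun v hv =>
    lt_of_le_of_ne (hle v (Finset.mem_of_mem_erase hv)) (Finset.ne_of_mem_erase hv)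
  refine ⟨F, insert (a + 1) (F.erase a), ⟨SimpComplex.mem_level.2 ⟨hF, rfl⟩, ?_, a, haF, ha1, rfl⟩,
    a, ?_, rfl, rfl⟩
  · intro hB
    have hle : CompLE F (insert (a + 1) (F.erase a)) := by
      unfold CompLE
      rw [sort_insert_of_forall_lt (fun v hv => (hlt v hv).trans (lt_add_one a)),
        ← Finset.insert_erase haF, sort_insert_of_forall_lt hlt, Finset.insert_erase haF]
      exact List.rel_append (List.forall₂_same.2 fun _ _ => le_rfl)
        (List.Forall₂.cons (by omega) List.Forall₂.nil)
    have heq := hmax _ (SimpComplex.mem_level.1 hB).1 hle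
    exact ha1 (heq ▸ Finset.mem_insert_self _ _)
  · rw [Finset.mem_sdiff, Finset.mem_insert]
    refine ⟨haF, ?_⟩
    rintro (h | h)
    · omega
    · exact Finset.notMem_erase _ _ h

theorem insert_filter_lt_max' {F : Finset ℤ} (hne : F.Nonempty) :
    insert (F.max' hne) (F.filter (· < F.max' hne)) = F := by
  ext v
  rw [Finset.mem_insert, Finset.mem_filter]
  constructor
  · rintro (rfl | h)
    · exact F.max'_mem hne
    · exact h.1
  · intro hv
    rcases (F.le_max' v hv).lt_or_eq with h | h
    · exact Or.inr ⟨hv, h⟩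
    · exact Or.inl h

theorem SimpComplex.exists_isLongSignature_of_maximal (Δ : SimpComplex) {F : Finset ℤ}
    (hF : F ∈ Δ.faces) (hne : F.Nonempty) (hmax : ∀ G ∈ Δ.faces, CompLE F G → G = F) :
    ∃ (S T : Finset ℤ) (t : ℤ), IsLongSignature (Δ.level F.card) S T ∧
      IsGreatest (T : Set ℤ) t ∧ F = insert t S := by
  refine ⟨_, _, F.max' hne, isLongSignature_of_maximal Δ hF hne hmax, ?_,
    (insert_filter_lt_max' hne).symm⟩
  rw [Finset.coe_Icc]
  exact isGreatest_Icc (initialVertex_le (SimpComplex.mem_level.2 ⟨hF, rfl⟩) (F.max'_mem hne))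

theorem SimpComplex.mem_faces_iff_exists_isLongSignature {Δ : SimpComplex} (hΔ : Δ.IsShifted)
    {G : Finset ℤ} (hG : G.Nonempty) :
    G ∈ Δ.faces ↔ ∃ (k : ℕ) (S T : Finset ℤ) (t : ℤ), IsLongSignature (Δ.level k) S T ∧
      IsGreatest (T : Set ℤ) t ∧ G ⊆ T ∧ CompLE G (insert t S) := by
  constructor
  · intro hGΔ
    obtain ⟨F, hF, hGF, hmax⟩ := Δ.exists_maximal hGΔ
    have hne : F.Nonempty := by
      rw [← Finset.card_pos, ← hGF.card_eq, Finset.card_pos]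
      exact hG
    refine ⟨F.card, _, _, F.max' hne, isLongSignature_of_maximal Δ hF hne hmax, ?_, ?_, ?_⟩
    · rw [Finset.coe_Icc]
      exact isGreatest_Icc (initialVertex_le (SimpComplex.mem_level.2 ⟨hF, rfl⟩) (F.max'_mem hne))
    · intro v hv
      obtain ⟨w, hw, hvw⟩ := hGF.exists_le hv
      exact Finset.mem_Icc.2 ⟨initialVertex_le (SimpComplex.mem_level.2 ⟨hGΔ, hGF.card_eq⟩) hv,
        hvw.trans (F.le_max' w hw)⟩
    · rwa [insert_filter_lt_max']
  · rintro ⟨k, S, T, t, ⟨A, B, ⟨hA, -, -⟩, a, ha, rfl, rfl⟩, ht, hGT, hle⟩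
    -- The interval `[p, q]` may be larger than the vertex set. Since the initial vertex of the
    -- level lies in a face, it is at least `p`, so `G ⊆ T ⊆ [p, q]`; and `S ∪ {t}` is a face, being
    -- a subset of `A`.
    obtain ⟨p, q, hpq, hsh⟩ := hΔ
    have haA := (Finset.mem_sdiff.1 ha).1
    have hAΔ := (SimpComplex.mem_level.1 hA).1
    rw [Finset.coe_Icc] at ht
    obtain rfl : t = a := ht.unique (isGreatest_Icc (initialVertex_le hA haA))
    refine hsh G (insert t (A.filter (· < t))) (Δ.down_closed A hAΔ _ ?_) ?_ hle
    · exact Finset.insert_subset haA (Finset.filter_subset _ _)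
    · obtain ⟨F, hF, hv⟩ := exists_initialVertex_mem hA haA
      have h1 := Finset.mem_Icc.1 (hpq F (SimpComplex.mem_level.1 hF).1 hv)
      have h2 := Finset.mem_Icc.1 (hpq A hAΔ haA)
      exact hGT.trans (Finset.Icc_subset_Icc h1.1 h2.2)

variable (𝕜 : Type*) [Field 𝕜]

/-! ### Recovering long signatures from `z`-polynomials -/

theorem zPoly_eq_sum_headRatio (S T : Finset ℤ) :
    zPoly 𝕜 S.val T.val =
      ((T.val.map fun j => insert j (S.filter (· < j))).map (headRatio 𝕜)).sum := by
  rw [zPoly, ← Multiset.sum_map_mul_left, Multiset.map_map]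
  congr 1
  apply Multiset.map_congr rfl
  intro j _
  rw [Function.comp_apply, ← monomialx_cons_div, monomialX, monomialX, map_pow, div_pow]
  ring

/-- A long signature is determined by its `z`-polynomial. -/
theorem IsLongSignature.eq_of_zPoly_eq [CharZero 𝕜] {𝓕 𝓖 : Finset (Finset ℤ)}
    {S T S' T' : Finset ℤ} (h : IsLongSignature 𝓕 S T) (h' : IsLongSignature 𝓖 S' T')
    (hz : zPoly 𝕜 S.val T.val = zPoly 𝕜 S'.val T'.val) : S = S' ∧ T = T' := by
  rw [zPoly_eq_sum_headRatio, zPoly_eq_sum_headRatio] at hz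
  have hM := multiset_eq_of_sum_eq (linearIndependent_headRatio 𝕜) hz
  have hmax : ∀ (P : Finset ℤ) (j : ℤ), (insert j (P.filter (· < j))).max = j := by
    intro P j
    apply le_antisymm
    · apply Finset.max_le
      intro v hv
      rcases Finset.mem_insert.1 hv with rfl | hv
      · exact le_rfl
      · exact WithBot.coe_le_coe.2 (Finset.mem_filter.1 hv).2.le
    · exact Finset.le_max (Finset.mem_insert_self _ _)
  have hT : T = T' := by
    have := congrArg (Multiset.map Finset.max) hM
    simp only [Multiset.map_map, Function.comp_def, hmax] at this
    exact Finset.val_injective (Multiset.map_injective WithBot.coe_injective this)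
  refine ⟨?_, hT⟩
  obtain ⟨A, B, ⟨hA, -, -⟩, a, ha, rfl, rfl⟩ := h
  obtain ⟨A', B', ⟨hA', -, -⟩, a', ha', rfl, rfl⟩ := h'
  have haA := (Finset.mem_sdiff.1 ha).1
  have haA' := (Finset.mem_sdiff.1 ha').1
  have hg := isGreatest_Icc (initialVertex_le hA haA)
  have hg' := isGreatest_Icc (initialVertex_le hA' haA')
  rw [← Finset.coe_Icc, hT, Finset.coe_Icc] at hg
  obtain rfl : a = a' := hg.unique hg'
  -- Every element of `S` is below `a`, so the set indexed by `a` is all of `S ∪ {a}`; its partner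
  -- on the other side has the same maximum, hence the same index.
  have hmem := Multiset.mem_map_of_mem
    (fun j => insert j ((A.filter (· < a)).filter (· < j)))
    (show a ∈ (Finset.Icc (initialVertex 𝓕) a).val from
      Finset.mem_Icc.2 ⟨initialVertex_le hA haA, le_refl a⟩)
  rw [hM] at hmem
  obtain ⟨j, _, hj⟩ := Multiset.mem_map.1 hmem
  have hja : j = a := by
    have := congrArg Finset.max hj
    rw [hmax, hmax] at this
    exact WithBot.coe_injective this
  subst hja
  have := congrArg (Finset.erase · j) hj
  simpa [Finset.filter_filter] using this.symm

/-! ### Traces and spectra -/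

/-- The two entries coincide, so the sign squares away and the squared weight depends only on an
initial segment. At most one `j` contributes to the sum. -/
theorem boundary_mul_coboundary_apply (Δ : SimpComplex) (k : ℕ) (G : Δ.level k)
    (F : Δ.level (k + 1)) :
    boundary 𝕜 Δ k G F * coboundary 𝕜 Δ k F G =
      ∑ j ∈ F.1, if F.1.erase j = G.1 then
        (raise 𝕜)^[Δ.size - (k + 1)] (headRatio 𝕜 (insert j (F.1.filter (· < j)))) else 0 := by
  obtain ⟨G, hG⟩ := G
  obtain ⟨F, hF⟩ := F
  simp only [boundary, coboundary]
  by_cases hex : ∃ v ∈ F, F.erase v = G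
  · obtain ⟨v, hv, rfl⟩ := hex
    have huniq : ∀ u ∈ F, u ≠ v → F.erase u ≠ F.erase v := fun u hu huv h =>
      huv (Finset.erase_injOn F hu hv h)
    rw [Finset.sum_eq_single v, Finset.sum_eq_single v, Finset.sum_eq_single v, if_pos rfl,
      if_pos rfl, if_pos (Finset.insert_erase hv), Finset.insert_erase hv]
    · have hs : sgn 𝕜 v F ^ 2 = 1 := by
        rw [sgn, if_pos hv, ← pow_mul, mul_comm, pow_mul, neg_one_sq, one_pow]
      have hval : v ::ₘ (F.erase v).val = F.val := by
        rw [← Finset.insert_val_of_notMem (Finset.notMem_erase v F), Finset.insert_erase hv]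
      have hfil : (F.erase v).filter (· < v) = F.filter (· < v) := by
        ext u
        simp only [Finset.mem_filter, Finset.mem_erase]
        exact ⟨fun h => ⟨h.1.2, h.2⟩, fun h => ⟨⟨h.2.ne, h.1⟩, h.2⟩⟩
      have hr := monomialx_cons_div 𝕜 (F.erase v) v
      rw [hval, hfil] at hr
      rw [← hr, Function.iterate_succ_apply, ← RingHom.coe_pow, map_pow, map_div₀]
      linear_combination ((raise 𝕜 ^ (Δ.size - (k + 1))) (monomialx 𝕜 F.val) /
        (raise 𝕜 ^ (Δ.size - (k + 1))) (raise 𝕜 (monomialx 𝕜 (F.erase v).val))) ^ 2 * hs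
    · exact fun u hu huv => if_neg (huniq u hu huv)
    · exact fun h => absurd hv h
    · intro u hu huv
      rw [Finset.mem_sdiff, Finset.mem_erase] at hu
      exact absurd ⟨huv, hu.1⟩ hu.2
    · intro h
      exact absurd (Finset.mem_sdiff.2 ⟨hv, Finset.notMem_erase v F⟩) h
    · exact fun u hu huv => if_neg (huniq u hu huv)
    · exact fun h => absurd hv h
  · have h0 : ∀ v ∈ F, F.erase v ≠ G := fun v hv h => hex ⟨v, hv, h⟩
    rw [Finset.sum_eq_zero fun v hv => if_neg (h0 v hv),
      Finset.sum_eq_zero fun v hv => if_neg (h0 v hv), zero_mul]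

/-- The initial segments of the members of `𝓕`, listed with multiplicity. -/
def initialSegments (𝓕 : Finset (Finset ℤ)) : Multiset (Finset ℤ) :=
  𝓕.val.bind fun F => F.val.map fun j => insert j (F.filter (· < j))

theorem trace_upDownLaplacian (Δ : SimpComplex) (k : ℕ) :
    (upDownLaplacian 𝕜 Δ k).trace = (raise 𝕜)^[Δ.size - (k + 1)]
      (((initialSegments (Δ.level (k + 1))).map (headRatio 𝕜)).sum) := by
  have hsum : ((initialSegments (Δ.level (k + 1))).map (headRatio 𝕜)).sum =
      ∑ F ∈ Δ.level (k + 1), ∑ j ∈ F, headRatio 𝕜 (insert j (F.filter (· < j))) := by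
    rw [initialSegments, Multiset.map_bind, Multiset.sum_bind]
    simp only [Multiset.map_map]
    rfl
  rw [hsum, ← RingHom.coe_pow, map_sum, ← Finset.sum_coe_sort (Δ.level (k + 1)), upDownLaplacian,
    Matrix.trace]
  simp only [Matrix.diag_apply, Matrix.mul_apply, boundary_mul_coboundary_apply,
    ← RingHom.coe_pow]
  rw [Finset.sum_comm]
  apply Finset.sum_congr rfl
  rintro ⟨F, hF⟩ -
  rw [Finset.sum_comm, map_sum]
  apply Finset.sum_congr rfl
  intro j hj
  have hmem : F.erase j ∈ Δ.level k := by
    rw [SimpComplex.mem_level] at hF ⊢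
    refine ⟨Δ.down_closed F hF.1 _ (Finset.erase_subset _ _), ?_⟩
    rw [Finset.card_erase_of_mem hj, hF.2, Nat.add_sub_cancel]
  rw [Finset.sum_eq_single ⟨F.erase j, hmem⟩]
  · simp
  · intro G _ hG
    exact if_neg fun h => hG (Subtype.ext h.symm)
  · exact fun h => absurd (Finset.mem_univ _) h

/-- Over an algebraic closure the characteristic polynomial splits, so its roots sum to the trace.
-/
theorem sum_spec (Δ : SimpComplex) (k : ℕ) :
    (spec 𝕜 Δ k).sum = algebraMap _ _ (upDownLaplacian 𝕜 Δ k).trace := by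
  rw [spec, Polynomial.aroots, ← Matrix.charpoly_map, ← Matrix.trace_eq_sum_roots_charpoly,
    ← AddMonoidHom.map_trace]

/-- An initial segment as large as the set it comes from is the whole set, so proper initial
segments do not interfere. -/
theorem mem_initialSegments_iff {𝓕 : Finset (Finset ℤ)} {G : Finset ℤ} (hG : G.Nonempty)
    (hcard : ∀ F ∈ 𝓕, F.card = G.card) : G ∈ initialSegments 𝓕 ↔ G ∈ 𝓕 := by
  simp only [initialSegments, Multiset.mem_bind, Multiset.mem_map, Finset.mem_val]
  constructor
  · rintro ⟨F, hF, j, hj, rfl⟩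
    have hsub := Finset.insert_subset hj (Finset.filter_subset (· < j) F)
    rwa [Finset.eq_of_subset_of_card_le hsub (hcard F hF).le]
  · exact fun h => ⟨G, h, G.max' hG, G.max'_mem hG, insert_filter_lt_max' hG⟩

theorem SimpComplex.card_le_size {Δ : SimpComplex} {F : Finset ℤ} (hF : F ∈ Δ.faces) :
    F.card ≤ Δ.size :=
  Finset.le_sup (f := Finset.card) hF

/-- A simplicial complex is determined by its family of spectra. -/
theorem SimpComplex.eq_of_spectra_eq [CharZero 𝕜] {Δ Γ : SimpComplex}
    (h : spectra 𝕜 Δ = spectra 𝕜 Γ) : Δ = Γ := by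
  -- Equal sizes make the power of `↑` in both traces the same, and `↑` is injective, so it can be
  -- stripped off.
  have hsize : Δ.size = Γ.size := by simpa [spectra] using congrArg List.length h
  have hlevel : ∀ k < Δ.size, initialSegments (Δ.level (k + 1)) =
      initialSegments (Γ.level (k + 1)) := by
    intro k hk
    have hspec : spec 𝕜 Δ k = spec 𝕜 Γ k := by
      have := congrArg (·[k]?) h
      simpa [spectra, hk, ← hsize] using this
    have htr := congrArg Multiset.sum hspec
    rw [sum_spec, sum_spec] at htr
    have htr' := FaithfulSMul.algebraMap_injective (RatField 𝕜) _ htr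
    rw [trace_upDownLaplacian, trace_upDownLaplacian, hsize] at htr'
    exact multiset_eq_of_sum_eq (linearIndependent_headRatio 𝕜)
      ((raise 𝕜).injective.iterate _ htr')
  ext F
  rcases F.eq_empty_or_nonempty with rfl | hF
  · exact iff_of_true Δ.empty_mem Γ.empty_mem
  · obtain ⟨k, hk⟩ := Nat.exists_eq_add_of_lt (Finset.card_pos.2 hF)
    rw [zero_add] at hk
    have hmem : ∀ Λ : SimpComplex, F ∈ Λ.faces ↔ F ∈ initialSegments (Λ.level (k + 1)) := by
      intro Λ
      rw [mem_initialSegments_iff hF, SimpComplex.mem_level, and_iff_left hk]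
      exact fun H hH => ((SimpComplex.mem_level.1 hH).2).trans hk.symm
    constructor
    · intro h
      rwa [hmem, ← hlevel k (by have := card_le_size h; omega), ← hmem]
    · intro h
      rwa [hmem, hlevel k (by have := card_le_size h; omega), ← hmem]

end
end FineShifted

theorem corollary7p8 (𝕜 : Type*) [Field 𝕜] [CharZero 𝕜] :
    -- a shifted complex is determined by its family of spectra
    (∀ Δ Γ : FineShifted.SimpComplex, Δ.IsShifted → Γ.IsShifted →
      FineShifted.spectra 𝕜 Δ = FineShifted.spectra 𝕜 Γ → Δ = Γ) ∧
    -- the long signature of a critical pair is determined by its z-polynomial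
    (∀ (𝓕 𝓖 : Finset (Finset ℤ)) (S T S' T' : Finset ℤ),
      FineShifted.IsLongSignature 𝓕 S T → FineShifted.IsLongSignature 𝓖 S' T' →
      FineShifted.zPoly 𝕜 S.val T.val = FineShifted.zPoly 𝕜 S'.val T'.val →
      S = S' ∧ T = T') ∧
    -- every nonempty face that is maximal in the componentwise order is read off
    -- as `S ∪ {max T}` from a long signature `(S, T)` in its dimension
    (∀ Δ : FineShifted.SimpComplex, Δ.IsShifted → ∀ F ∈ Δ.faces, F.Nonempty →
      (∀ G ∈ Δ.faces, FineShifted.CompLE F G → G = F) →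
      ∃ (S T : Finset ℤ) (t : ℤ), FineShifted.IsLongSignature (Δ.level F.card) S T ∧
        IsGreatest (T : Set ℤ) t ∧ F = insert t S) ∧
    -- the long signatures recover all nonempty faces
    (∀ Δ : FineShifted.SimpComplex, Δ.IsShifted → ∀ G : Finset ℤ, G.Nonempty →
      (G ∈ Δ.faces ↔ ∃ (k : ℕ) (S T : Finset ℤ) (t : ℤ),
        FineShifted.IsLongSignature (Δ.level k) S T ∧ IsGreatest (T : Set ℤ) t ∧
        G ⊆ T ∧ FineShifted.CompLE G (insert t S))) := by
  exact ⟨fun Δ Γ _ _ h => FineShifted.SimpComplex.eq_of_spectra_eq 𝕜 h,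
    fun 𝓕 𝓖 S T S' T' h h' hz => h.eq_of_zPoly_eq 𝕜 h' hz,
    fun Δ _ F hF hne hmax => Δ.exists_isLongSignature_of_maximal hF hne hmax,
    fun Δ hΔ G hG => FineShifted.SimpComplex.mem_faces_iff_exists_isLongSignature hΔ hG⟩
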